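/- Let $S$ be a finite regular semigroup and let $\ast$ be an involution on $S$ (so $a^{\ast\ast}=a$ and $(ab)^\ast=b^\ast a^\ast$). For an idempotent $e\in S$ let $L_e$, $R_e$ be its $\mathcal L$- and $\mathcal R$-classes and $G_e$ the group of units of the monoid $eSe$. A *pair of matrix Schützenberger representations of $S$ associated to a $\mathcal J$-class $J$* is built from the following choices: an idempotent $e\in J$; decompositions into disjoint unions $L_e=\bigsqcup_{i=1}^m x_iG_e$ and $R_e=\bigsqcup_{j=1}^n G_ey_j$; and a complete list $\sigma_1,\dots,\sigma_k$ of pairwise inequivalent irreducible complex matrix representations of $G_e$. Put $\sigma=\sigma_1\oplus\dots\oplus\sigma_k$ (block diagonal) and $\sigma(0)=0$. The pair consists of the block matrix representations $$\mathrm{Ind}_{G_e}(\sigma)(s)=\bigl(\sigma(g_{ji}(s))\bigr)_{1\le j,i\le m},\qquad \mathrm{Coind}_{G_e}(\sigma)(s)=\bigl(\sigma(h_{ji}(s))\bigr)_{1\le j,i\le n}\qquad(s\in S),$$ where $g_{ji}(s)$ is the unique $g\in G_e$ with $sx_i=x_jg$ if it exists and $0$ otherwise, and $h_{ji}(s)$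 is the unique $h\in G_e$ with $y_js=hy_i$ if it exists and $0$ otherwise. A matrix representation $\pi$ of $S$ is *semiunitary* if $\pi(s)\pi(s)^\ast\pi(s)=\pi(s)$ for all $s\in S$, and is a *$\ast$-representation* if $\pi(s^\ast)=\pi(s)^\ast$ for all $s\in S$, where $A^\ast$ denotes the conjugate transpose of a complex matrix $A$. **Theorem.** The following are equivalent: 1. $S$ is an inverse semigroup (every $a\in S$ has a unique $b\in S$ with $aba=a$ and $bab=b$) and the inverse of $a$ is $a^\ast$ for every $a\in S$. 2. For each $\mathcal J$-class of $S$ there exists a pair of matrix Schützenberger representations of $S$ associated to it such that both members of the pair are semiunitary $\ast$-representations. -/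

import Mathlib

namespace SchutzenbergerRep

open Matrix

/-! ### Regular and inverse semigroups, Green's relations -/

section Semigroups

variable {S : Type*} [Semigroup S]

/-- A semigroup is (von Neumann) regular if every `a` has some `b` with `a b a = a`. -/
def IsRegularSemigroup (S : Type*) [Semigroup S] : Prop :=
  ∀ a : S, ∃ b : S, a * b * a = a

/-- `S` is an inverse semigroup: each `a` has exactly one `b` with `a b a = a`, `b a b = b`. -/
def IsInverseSemigroup (S : Type*) [Semigroup S] : Prop :=
  ∀ a : S, ∃! b : S, a * b * a = a ∧ b * a * b = b

/-- `S` is an inverse semigroup and `f a` is the inverse of `a`, for every `a`. -/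
def IsInverseSemigroupWith (f : S → S) : Prop :=
  IsInverseSemigroup S ∧ ∀ a : S, a * f a * a = a ∧ f a * a * f a = f a

/-- The principal left ideal `S¹ a`. -/
def principalLeft (a : S) : Set S := {b | b = a ∨ ∃ s, b = s * a}

/-- The principal right ideal `a S¹`. -/
def principalRight (a : S) : Set S := {b | b = a ∨ ∃ t, b = a * t}

/-- The principal two-sided ideal `S¹ a S¹`. -/
def principalTwoSided (a : S) : Set S :=
  {b | b = a ∨ (∃ s, b = s * a) ∨ (∃ t, b = a * t) ∨ ∃ s t, b = s * a * t}

/-- Green's relation `L`. -/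
def GreenL (a b : S) : Prop := principalLeft a = principalLeft b

/-- Green's relation `R`. -/
def GreenR (a b : S) : Prop := principalRight a = principalRight b

/-- Green's relation `J`. -/
def GreenJ (a b : S) : Prop := principalTwoSided a = principalTwoSided b

end Semigroups

/-! ### The group `G_e` of units of the monoid `e S e` -/

section MaximalSubgroup

variable {S : Type*} [Semigroup S] {e : S}

/-- For an idempotent `e`, the set `e S e` is a monoid with identity `e`. -/
instance cornerMonoid (he : IsIdempotentElem e) : Monoid he.Corner where
  mul a b := ⟨a.1 * b.1, (Subsemigroup.corner e).mul_mem a.2 b.2⟩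
  mul_assoc a b c := Subtype.ext (mul_assoc a.1 b.1 c.1)
  one := ⟨e, e, by simp only [he.eq]⟩
  one_mul a := Subtype.ext ((Subsemigroup.mem_corner_iff he).mp a.2).1
  mul_one a := Subtype.ext ((Subsemigroup.mem_corner_iff he).mp a.2).2

/-- The group `G_e` of units of the monoid `e S e`. -/
abbrev MaxSubgroup (he : IsIdempotentElem e) : Type _ := he.Cornerˣ

/-- An element of `G_e`, viewed in `S`. -/
def toS {he : IsIdempotentElem e} (g : MaxSubgroup he) : S := g.val.1

theorem toS_mul {he : IsIdempotentElem e} (g h : MaxSubgroup he) :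
    toS (g * h) = toS g * toS h := rfl

theorem toS_one {he : IsIdempotentElem e} : toS (1 : MaxSubgroup he) = e := rfl

theorem toS_injective {he : IsIdempotentElem e} {g h : MaxSubgroup he} (H : toS g = toS h) :
    g = h := Units.ext (Subtype.ext H)

theorem toS_mul_inv {he : IsIdempotentElem e} (g : MaxSubgroup he) :
    toS g * toS g⁻¹ = e := by rw [← toS_mul, mul_inv_cancel, toS_one]

theorem toS_inv_mul {he : IsIdempotentElem e} (g : MaxSubgroup he) :
    toS g⁻¹ * toS g = e := by rw [← toS_mul, inv_mul_cancel, toS_one]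

theorem e_mul_toS {he : IsIdempotentElem e} (g : MaxSubgroup he) : e * toS g = toS g :=
  ((Subsemigroup.mem_corner_iff he).mp g.val.2).1

theorem toS_mul_e {he : IsIdempotentElem e} (g : MaxSubgroup he) : toS g * e = toS g :=
  ((Subsemigroup.mem_corner_iff he).mp g.val.2).2

end MaximalSubgroup

/-! ### Transversals of `L_e` and `R_e`, Schützenberger matrices over `G_e ∪ {0}` -/

section Transversals

variable {S : Type*} [Semigroup S] {e : S}

/-- A decomposition `L_e = ⊔ i, x i * G_e` of the `L`-class of `e`. -/
structure LeftTransversal (he : IsIdempotentElem e) (m : ℕ) where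
  x : Fin m → S
  mem : ∀ i, GreenL (x i) e
  cover : ∀ b, GreenL b e → ∃ (i : Fin m) (g : MaxSubgroup he), b = x i * toS g
  disjoint : ∀ (i j : Fin m) (g h : MaxSubgroup he), x i * toS g = x j * toS h → i = j

/-- A decomposition `R_e = ⊔ j, G_e * y j` of the `R`-class of `e`. -/
structure RightTransversal (he : IsIdempotentElem e) (n : ℕ) where
  y : Fin n → S
  mem : ∀ j, GreenR (y j) e
  cover : ∀ b, GreenR b e → ∃ (j : Fin n) (g : MaxSubgroup he), b = toS g * y j
  disjoint : ∀ (i j : Fin n) (g h : MaxSubgroup he), toS g * y i = toS h * y j → i = j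

variable {he : IsIdempotentElem e} {m n : ℕ}

theorem LeftTransversal.x_mul_e (X : LeftTransversal he m) (i : Fin m) : X.x i * e = X.x i := by
  have h : X.x i ∈ principalLeft e := (X.mem i) ▸ (Or.inl rfl : X.x i ∈ principalLeft (X.x i))
  rcases h with h | ⟨s, h⟩
  · rw [h, he.eq]
  · rw [h, mul_assoc, he.eq]

theorem LeftTransversal.cancel (X : LeftTransversal he m) (i : Fin m) {g h : MaxSubgroup he}
    (H : X.x i * toS g = X.x i * toS h) : g = h := by
  have h1 : e ∈ principalLeft (X.x i) := (X.mem i).symm ▸ (Or.inl rfl : e ∈ principalLeft e)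
  apply toS_injective
  rcases h1 with h1 | ⟨s, h1⟩
  · rw [← h1] at H; rwa [e_mul_toS, e_mul_toS] at H
  · calc toS g = e * toS g := (e_mul_toS g).symm
      _ = s * X.x i * toS g := congrArg (· * toS g) h1
      _ = s * X.x i * toS h := by rw [mul_assoc, H, mul_assoc]
      _ = e * toS h := congrArg (· * toS h) h1.symm
      _ = toS h := e_mul_toS h

theorem RightTransversal.e_mul_y (Y : RightTransversal he n) (j : Fin n) : e * Y.y j = Y.y j := by
  have h : Y.y j ∈ principalRight e := (Y.mem j) ▸ (Or.inl rfl : Y.y j ∈ principalRight (Y.y j))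
  rcases h with h | ⟨s, h⟩
  · rw [h, he.eq]
  · rw [h, ← mul_assoc, he.eq]

theorem RightTransversal.cancel (Y : RightTransversal he n) (j : Fin n) {g h : MaxSubgroup he}
    (H : toS g * Y.y j = toS h * Y.y j) : g = h := by
  have h1 : e ∈ principalRight (Y.y j) := (Y.mem j).symm ▸ (Or.inl rfl : e ∈ principalRight e)
  apply toS_injective
  rcases h1 with h1 | ⟨s, h1⟩
  · rw [← h1] at H; rwa [toS_mul_e, toS_mul_e] at H
  · calc toS g = toS g * e := (toS_mul_e g).symm
      _ = toS g * (Y.y j * s) := congrArg (toS g * ·) h1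
      _ = toS h * (Y.y j * s) := by rw [← mul_assoc, H, mul_assoc]
      _ = toS h * e := congrArg (toS h * ·) h1.symm
      _ = toS h := toS_mul_e h

open Classical in
/-- The left Schützenberger matrix of `s`: its `(j, i)` entry is the unique `g ∈ G_e` with
`s * x i = x j * g` if there is one, and `0` otherwise. -/
noncomputable def LeftTransversal.coeff (X : LeftTransversal he m) (s : S) :
    Matrix (Fin m) (Fin m) (WithZero (MaxSubgroup he)) :=
  Matrix.of fun j i =>
    if h : ∃ g : MaxSubgroup he, s * X.x i = X.x j * toS g then (h.choose : WithZero _) else 0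

open Classical in
/-- The right Schützenberger matrix of `s`: its `(j, i)` entry is the unique `h ∈ G_e` with
`y j * s = h * y i` if there is one, and `0` otherwise. -/
noncomputable def RightTransversal.coeff (Y : RightTransversal he n) (s : S) :
    Matrix (Fin n) (Fin n) (WithZero (MaxSubgroup he)) :=
  Matrix.of fun j i =>
    if h : ∃ g : MaxSubgroup he, Y.y j * s = toS g * Y.y i then (h.choose : WithZero _) else 0

theorem LeftTransversal.coeff_eq (X : LeftTransversal he m) {s : S} {i j : Fin m}
    {g : MaxSubgroup he} (h : s * X.x i = X.x j * toS g) : X.coeff s j i = g := by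
  have h' : ∃ g : MaxSubgroup he, s * X.x i = X.x j * toS g := ⟨g, h⟩
  simp only [LeftTransversal.coeff, of_apply, dif_pos h']
  rw [X.cancel j (h'.choose_spec.symm.trans h)]

theorem LeftTransversal.coeff_zero (X : LeftTransversal he m) {s : S} {i j : Fin m}
    (h : ∀ g : MaxSubgroup he, s * X.x i ≠ X.x j * toS g) : X.coeff s j i = 0 := by
  simp only [LeftTransversal.coeff, of_apply]
  exact dif_neg (by rintro ⟨g, hg⟩; exact h g hg)

theorem RightTransversal.coeff_eq (Y : RightTransversal he n) {s : S} {i j : Fin n}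
    {g : MaxSubgroup he} (h : Y.y j * s = toS g * Y.y i) : Y.coeff s j i = g := by
  have h' : ∃ g : MaxSubgroup he, Y.y j * s = toS g * Y.y i := ⟨g, h⟩
  simp only [RightTransversal.coeff, of_apply, dif_pos h']
  rw [Y.cancel i (h'.choose_spec.symm.trans h)]

theorem RightTransversal.coeff_zero (Y : RightTransversal he n) {s : S} {i j : Fin n}
    (h : ∀ g : MaxSubgroup he, Y.y j * s ≠ toS g * Y.y i) : Y.coeff s j i = 0 := by
  simp only [RightTransversal.coeff, of_apply]
  exact dif_neg (by rintro ⟨g, hg⟩; exact h g hg)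

end Transversals

/-! ### Matrix representations of a group, and their extension to matrices over `G ∪ {0}` -/

section GroupReps

variable {G : Type*} [Group G]

/-- The representation on column vectors attached to a matrix representation of a group. -/
noncomputable def toRep {d : ℕ} (σ : G →* Matrix (Fin d) (Fin d) ℂ) :
    Representation ℂ G (Fin d → ℂ) :=
  (Matrix.toLinAlgEquiv' : Matrix (Fin d) (Fin d) ℂ ≃ₐ[ℂ] _).toMonoidHom.comp σ

/-- `σ 0, …, σ (k-1)` is a complete list of pairwise inequivalent irreducible complex matrix
representations of `G`. -/
structure IsCompleteIrreducibleList {k : ℕ} {d : Fin k → ℕ}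
    (σ : ∀ i, G →* Matrix (Fin (d i)) (Fin (d i)) ℂ) : Prop where
  irreducible : ∀ i, (toRep (σ i)).IsIrreducible
  inequivalent : ∀ i j, Nonempty ((toRep (σ i)).Equiv (toRep (σ j))) → i = j
  complete : ∀ (c : ℕ) (τ : G →* Matrix (Fin c) (Fin c) ℂ), (toRep τ).IsIrreducible →
    ∃ i, Nonempty ((toRep τ).Equiv (toRep (σ i)))

/-- The direct sum of matrix representations, as block diagonal matrices. -/
def directSum {k : ℕ} {d : Fin k → ℕ} (σ : ∀ i, G →* Matrix (Fin (d i)) (Fin (d i)) ℂ) :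
    G →* Matrix (Σ i, Fin (d i)) (Σ i, Fin (d i)) ℂ where
  toFun g := Matrix.blockDiagonal' fun i => σ i g
  map_one' := by simp only [map_one]; exact Matrix.blockDiagonal'_one
  map_mul' g h := by simp only [map_mul]; exact Matrix.blockDiagonal'_mul _ _

variable {κ : Type*} [Fintype κ] [DecidableEq κ]

/-- `σ` extended to `G ∪ {0}` by `σ 0 = 0`. -/
def extendZero (σ : G →* Matrix κ κ ℂ) : WithZero G → Matrix κ κ ℂ
  | none => 0
  | some g => σ g

/-- `σ` applied entrywise to a matrix over `G ∪ {0}`; the result is a block matrix. -/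
def mapBlocks {ι : Type*} (σ : G →* Matrix κ κ ℂ) (M : Matrix ι ι (WithZero G)) :
    Matrix (ι × κ) (ι × κ) ℂ :=
  Matrix.of fun a b => extendZero σ (M a.1 b.1) a.2 b.2

theorem extendZero_zero (σ : G →* Matrix κ κ ℂ) : extendZero σ 0 = 0 := rfl

theorem extendZero_coe (σ : G →* Matrix κ κ ℂ) (g : G) : extendZero σ (g : WithZero G) = σ g := rfl

theorem mapBlocks_mul_apply {ι : Type*} [Fintype ι] (σ : G →* Matrix κ κ ℂ)
    (M N : Matrix ι ι (WithZero G)) (a b : ι × κ) :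
    (mapBlocks σ M * mapBlocks σ N) a b =
      (∑ l, extendZero σ (M a.1 l) * extendZero σ (N l b.1)) a.2 b.2 := by
  simp only [Matrix.mul_apply, Fintype.sum_prod_type, mapBlocks, of_apply, Matrix.sum_apply]

end GroupReps

/-! ### Induced and coinduced matrix representations -/

section IndCoind

variable {S : Type*} [Semigroup S] {e : S} {he : IsIdempotentElem e} {m n : ℕ}
variable {κ : Type*} [Fintype κ] [DecidableEq κ]

/-- The matrix representation `Ind σ` of `S`: the left Schützenberger matrices, with `σ` applied
to the entries. -/
noncomputable def ind (X : LeftTransversal he m) (σ : MaxSubgroup he →* Matrix κ κ ℂ) :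
    S →ₙ* Matrix (Fin m × κ) (Fin m × κ) ℂ where
  toFun s := mapBlocks σ (X.coeff s)
  map_mul' s t := by
    ext a b
    obtain ⟨j, p⟩ := a
    obtain ⟨i, q⟩ := b
    rw [mapBlocks_mul_apply]
    simp only [mapBlocks, of_apply]
    by_cases h : ∃ (l : Fin m) (g : MaxSubgroup he), t * X.x i = X.x l * toS g
    · obtain ⟨l, g, hg⟩ := h
      rw [Finset.sum_eq_single l]
      · rw [X.coeff_eq hg]
        by_cases h2 : ∃ h : MaxSubgroup he, s * X.x l = X.x j * toS h
        · obtain ⟨h, hh⟩ := h2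
          have : s * t * X.x i = X.x j * toS (h * g) := by
            rw [mul_assoc, hg, ← mul_assoc, hh, toS_mul, mul_assoc]
          rw [X.coeff_eq hh, X.coeff_eq this]
          simp only [extendZero_coe, map_mul]
        · push Not at h2
          rw [X.coeff_zero h2, X.coeff_zero, extendZero_zero, zero_mul]
          intro h hh
          apply h2 (h * g⁻¹)
          rw [toS_mul, ← mul_assoc, ← hh, mul_assoc s, hg, mul_assoc s, mul_assoc, toS_mul_inv,
            X.x_mul_e]
      · intro l' _ hl'
        rw [X.coeff_zero (j := l') (i := i), extendZero_zero, mul_zero]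
        intro g' hg'
        exact hl' (X.disjoint _ _ _ _ (hg'.symm.trans hg))
      · simp
    · rw [Finset.sum_eq_zero, X.coeff_zero, extendZero_zero]
      · intro g hg
        apply h
        apply X.cover
        have he' : e = toS g⁻¹ * toS g := (toS_inv_mul g).symm
        have h1 : e ∈ principalLeft (X.x j) := (X.mem j).symm ▸ (Or.inl rfl : e ∈ principalLeft e)
        have h2 : ∃ u, e = u * (t * X.x i) := by
          rcases h1 with h1 | ⟨u, h1⟩
          · refine ⟨toS g⁻¹ * s, ?_⟩
            rw [mul_assoc, ← mul_assoc s, hg, ← h1, e_mul_toS, toS_inv_mul]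
          · refine ⟨toS g⁻¹ * u * s, ?_⟩
            rw [mul_assoc _ s, ← mul_assoc s, hg, mul_assoc _ u, ← mul_assoc u, ← h1, e_mul_toS,
              toS_inv_mul]
        obtain ⟨u, hu⟩ := h2
        apply Set.Subset.antisymm
        · rintro b (rfl | ⟨v, rfl⟩)
          · exact Or.inr ⟨t * X.x i, by rw [mul_assoc, X.x_mul_e]⟩
          · exact Or.inr ⟨v * (t * X.x i), by rw [mul_assoc v, mul_assoc t, X.x_mul_e]⟩
        · rintro b (rfl | ⟨v, rfl⟩)
          · exact Or.inr ⟨u, hu⟩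
          · exact Or.inr ⟨v * u, by rw [mul_assoc v, ← hu]⟩
      · intro l _
        rw [X.coeff_zero (j := l) (i := i), extendZero_zero, mul_zero]
        intro g hg
        exact h ⟨l, g, hg⟩

/-- The matrix representation `Coind σ` of `S`: the right Schützenberger matrices, with `σ`
applied to the entries. -/
noncomputable def coind (Y : RightTransversal he n) (σ : MaxSubgroup he →* Matrix κ κ ℂ) :
    S →ₙ* Matrix (Fin n × κ) (Fin n × κ) ℂ where
  toFun s := mapBlocks σ (Y.coeff s)
  map_mul' s t := by
    ext a b
    obtain ⟨j, p⟩ := a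
    obtain ⟨i, q⟩ := b
    rw [mapBlocks_mul_apply]
    simp only [mapBlocks, of_apply]
    by_cases h : ∃ (l : Fin n) (g : MaxSubgroup he), Y.y j * s = toS g * Y.y l
    · obtain ⟨l, g, hg⟩ := h
      rw [Finset.sum_eq_single l]
      · rw [Y.coeff_eq hg]
        by_cases h2 : ∃ h : MaxSubgroup he, Y.y l * t = toS h * Y.y i
        · obtain ⟨h, hh⟩ := h2
          have : Y.y j * (s * t) = toS (g * h) * Y.y i := by
            rw [← mul_assoc, hg, mul_assoc, hh, toS_mul, mul_assoc]
          rw [Y.coeff_eq hh, Y.coeff_eq this]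
          simp only [extendZero_coe, map_mul]
        · push Not at h2
          rw [Y.coeff_zero h2, Y.coeff_zero, extendZero_zero, mul_zero]
          intro h hh
          apply h2 (g⁻¹ * h)
          rw [toS_mul, mul_assoc, ← hh, ← mul_assoc (Y.y j), hg, ← mul_assoc, ← mul_assoc,
            toS_inv_mul, Y.e_mul_y]
      · intro l' _ hl'
        rw [Y.coeff_zero (j := j) (i := l'), extendZero_zero, zero_mul]
        intro g' hg'
        exact hl' (Y.disjoint _ _ _ _ (hg'.symm.trans hg))
      · simp
    · rw [Finset.sum_eq_zero, Y.coeff_zero, extendZero_zero]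
      · intro g hg
        apply h
        apply Y.cover
        have h1 : e ∈ principalRight (Y.y i) :=
          (Y.mem i).symm ▸ (Or.inl rfl : e ∈ principalRight e)
        have h2 : ∃ u, e = Y.y j * s * u := by
          rcases h1 with h1 | ⟨u, h1⟩
          · refine ⟨t * toS g⁻¹, ?_⟩
            rw [← mul_assoc, mul_assoc _ s t, hg, ← h1, toS_mul_e, toS_mul_inv]
          · refine ⟨t * u * toS g⁻¹, ?_⟩
            rw [← mul_assoc, ← mul_assoc, mul_assoc _ s t, hg, mul_assoc _ _ u, ← h1, toS_mul_e,
              toS_mul_inv]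
        obtain ⟨u, hu⟩ := h2
        apply Set.Subset.antisymm
        · rintro b (rfl | ⟨v, rfl⟩)
          · exact Or.inr ⟨Y.y j * s, by rw [← mul_assoc, Y.e_mul_y]⟩
          · exact Or.inr ⟨Y.y j * s * v, by rw [← mul_assoc, ← mul_assoc, Y.e_mul_y]⟩
        · rintro b (rfl | ⟨v, rfl⟩)
          · exact Or.inr ⟨u, hu⟩
          · exact Or.inr ⟨u * v, by rw [← mul_assoc, ← hu]⟩
      · intro l _
        rw [Y.coeff_zero (j := j) (i := l), extendZero_zero, zero_mul]
        intro g hg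
        exact h ⟨l, g, hg⟩

end IndCoind

/-! ### Semiunitary representations, `*`-representations, Schützenberger pairs -/

section Pairs

variable {S : Type*} [Semigroup S]

/-- A square complex matrix is preunitary if `A A* A = A`. -/
def IsPreunitary {ι : Type*} [Fintype ι] (A : Matrix ι ι ℂ) : Prop := A * Aᴴ * A = A

/-- A matrix representation is semiunitary if all its values are preunitary. -/
def IsSemiunitary {ι : Type*} [Fintype ι] (π : S →ₙ* Matrix ι ι ℂ) : Prop :=
  ∀ s, IsPreunitary (π s)

/-- A matrix representation is a `*`-representation if it carries the involution of `S` to the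
conjugate transpose. -/
def IsStarRepresentation [StarMul S] {ι : Type*} [Fintype ι] (π : S →ₙ* Matrix ι ι ℂ) : Prop :=
  ∀ s, π (star s) = (π s)ᴴ

/-- The data of a pair of matrix Schützenberger representations of `S` associated to the
`J`-class of `a`: an idempotent `e` in that class, transversals of `L_e` and `R_e`, and a complete
list of pairwise inequivalent irreducible matrix representations of `G_e`. -/
structure SchutzenbergerPair (a : S) where
  e : S
  he : IsIdempotentElem e
  mem : GreenJ e a
  m : ℕ
  n : ℕ
  X : LeftTransversal he m
  Y : RightTransversal he n
  k : ℕ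
  d : Fin k → ℕ
  σ : ∀ i, MaxSubgroup he →* Matrix (Fin (d i)) (Fin (d i)) ℂ
  complete : IsCompleteIrreducibleList σ

/-- The left matrix Schützenberger representation `Ind (σ 1 ⊕ ⋯ ⊕ σ k)`. -/
noncomputable def SchutzenbergerPair.left {a : S} (P : SchutzenbergerPair a) :
    S →ₙ* Matrix (Fin P.m × Σ i, Fin (P.d i)) (Fin P.m × Σ i, Fin (P.d i)) ℂ :=
  ind P.X (directSum P.σ)

/-- The right matrix Schützenberger representation `Coind (σ 1 ⊕ ⋯ ⊕ σ k)`. -/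
noncomputable def SchutzenbergerPair.right {a : S} (P : SchutzenbergerPair a) :
    S →ₙ* Matrix (Fin P.n × Σ i, Fin (P.d i)) (Fin P.n × Σ i, Fin (P.d i)) ℂ :=
  coind P.Y (directSum P.σ)

end Pairs

end SchutzenbergerRep

/-!
The argument rests on two facts about a finite regular semigroup `S` and one about matrices.

*Separation.* The Schützenberger representations, taken over all `J`-classes, separate the points
of `S` (`eq_of_left_eq_of_right_eq`). A complete list of irreducible representations of the finite
group `G_e` is jointly faithful, because `ℂ[G_e]` is a sum of simple submodules
(`IsCompleteIrreducibleList.eq_one`); so equal block matrices come from equal matrices over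
`G_e ∪ {0}`, that is, from equal partial actions on `L_e` and `R_e`. As `J = D` in a finite
semigroup, these actions can be used to recover `a` from either side:
`P.left a = P.left b` gives `a = b u a`, and `Q.right b = Q.right a` gives `b = b v a`,
where `a u a = a` and `b v b = b`; together they force `a = b`.

*From representations to inverses.* A semiunitary `*`-representation identifies `a a* a` with `a`.
It sends an idempotent `e` to an idempotent partial isometry, which is an orthogonal projection
(`IsPreunitary.conjTranspose_eq_self`), so it identifies `e*` with `e`. By separation both
identities hold in `S`. Then a product `ef` of idempotents is idempotent, hence
`ef = (ef)* = fe`; a regular semigroup with commuting idempotents is inverse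
(`isInverseSemigroupWith_star`).

*From inverses to representations.* If `a*` is the inverse of `a`, then `s x = y g` with
`x, y ∈ L_e` is equivalent to `s* y = x g⁻¹` (`IsInverseSemigroupWith.star_mul_eq`), and dually on
`R_e`. Hence the matrix of `s*` over `G_e ∪ {0}` is the transpose of that of `s` with inverted
entries. With a unitary complete list of irreducible representations
(`exists_unitary_isCompleteIrreducibleList`) both members of the pair are `*`-representations, and
`a a* a = a` makes them semiunitary.
-/

namespace SchutzenbergerRep

open Matrix

/-! ### Irreducible matrix representations of a finite group -/

section IrreducibleReps

open scoped MonoidAlgebra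

variable {G : Type*} [Group G]

theorem isIrreducible_of_equiv {V W : Type*} [AddCommGroup V] [Module ℂ V] [AddCommGroup W]
    [Module ℂ W] {ρ : Representation ℂ G V} {τ : Representation ℂ G W} (φ : ρ.Equiv τ)
    (h : ρ.IsIrreducible) : τ.IsIrreducible := by
  rw [Representation.irreducible_iff_isSimpleModule_asModule] at h ⊢
  have hb : Function.Bijective
      (Representation.IntertwiningMap.equivLinearMapAsModule ρ τ φ.toIntertwiningMap) :=
    φ.toLinearEquiv.bijective
  exact IsSimpleModule.congr (LinearEquiv.ofBijective _ hb).symm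

theorem exists_matrix_of_representation {V : Type*} [AddCommGroup V] [Module ℂ V]
    [FiniteDimensional ℂ V] (ρ : Representation ℂ G V) :
    ∃ (c : ℕ) (τ : G →* Matrix (Fin c) (Fin c) ℂ), Nonempty (ρ.Equiv (toRep τ)) := by
  let b := Module.finBasis ℂ V
  refine ⟨_, (LinearMap.toMatrixAlgEquiv b).toMonoidHom.comp ρ,
    ⟨Representation.Equiv.mk b.equivFun fun g => ?_⟩⟩
  ext v
  simp [toRep, LinearMap.toMatrixAlgEquiv, LinearMap.toMatrix_mulVec_repr]

theorem nonempty_toRep_equiv {d : ℕ} {σ τ : G →* Matrix (Fin d) (Fin d) ℂ}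
    (B : (Matrix (Fin d) (Fin d) ℂ)ˣ) (h : ∀ g, B.val * σ g = τ g * B.val) :
    Nonempty ((toRep σ).Equiv (toRep τ)) := by
  refine ⟨Representation.Equiv.mk (Matrix.toLin'OfInv B.inv_mul B.mul_inv) fun g => ?_⟩
  refine LinearMap.ext fun v => ?_
  simpa [toRep, Matrix.toLin'OfInv, Matrix.mulVec_mulVec] using congrArg (· *ᵥ v) (h g)

open scoped ComplexOrder MatrixOrder Matrix.Norms.L2Operator in
/-- Unitarizability: `∑ g, (τ g)ᴴ * τ g` is a positive definite `G`-invariant form `Bᴴ * B`, and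
conjugation by `B` carries `τ` into the unitary group. -/
theorem exists_unitary_equiv [Finite G] {d : ℕ} (τ : G →* Matrix (Fin d) (Fin d) ℂ) :
    ∃ σ : G →* Matrix (Fin d) (Fin d) ℂ,
      (∀ g, σ g⁻¹ = (σ g)ᴴ) ∧ Nonempty ((toRep τ).Equiv (toRep σ)) := by
  cases nonempty_fintype G
  have hpos : (∑ g, (τ g)ᴴ * τ g).PosDef := by
    refine Matrix.posDef_sum Finset.univ_nonempty fun g _ => ?_
    refine Matrix.PosDef.conjTranspose_mul_self _ (Function.LeftInverse.injective
      (g := (τ g⁻¹).mulVec) fun v => ?_)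
    rw [Matrix.mulVec_mulVec, ← map_mul, inv_mul_cancel, map_one, Matrix.one_mulVec]
  obtain ⟨B, hB, hBB⟩ :=
    CStarAlgebra.isStrictlyPositive_iff_eq_star_mul_self.mp hpos.isStrictlyPositive
  obtain ⟨B, rfl⟩ := hB
  have hinv (g : G) : (τ g)ᴴ * (star B.val * B.val) * τ g = star B.val * B.val := by
    rw [← hBB, Finset.mul_sum, Finset.sum_mul]
    refine Fintype.sum_equiv (Equiv.mulRight g) _ _ fun x => ?_
    simp [Matrix.conjTranspose_mul, mul_assoc]
  let σ : G →* Matrix (Fin d) (Fin d) ℂ :=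
    (Units.coeHom _).comp ((MulAut.conj B).toMonoidHom.comp τ.toHomUnits)
  have hσ (g : G) : σ g = B.val * τ g * B⁻¹.val := rfl
  refine ⟨σ, fun g => ?_, nonempty_toRep_equiv B fun g => by simp [hσ]⟩
  have hunit : (σ g)ᴴ * σ g = 1 := by
    have h : (σ g)ᴴ * σ g = star B⁻¹.val * ((τ g)ᴴ * (star B.val * B.val) * τ g) * B⁻¹.val := by
      simp only [hσ, Matrix.conjTranspose_mul, Matrix.star_eq_conjTranspose, mul_assoc]
    rw [h, hinv, ← mul_assoc, ← star_mul, mul_assoc, B.mul_inv, star_one, mul_one]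
  calc σ g⁻¹ = (σ g)ᴴ * σ g * σ g⁻¹ := by rw [hunit, one_mul]
    _ = (σ g)ᴴ := by rw [mul_assoc, ← map_mul, mul_inv_cancel, map_one, mul_one]

/-- The forms `f ↦ |G|⁻¹ ∑ g, f g * χⱼ g⁻¹` are dual to the irreducible characters `χᵢ`. -/
theorem linearIndependent_characters [Finite G] {ι : Type*} {d : ι → ℕ}
    (σ : ∀ i, G →* Matrix (Fin (d i)) (Fin (d i)) ℂ) (hσ : ∀ i, (toRep (σ i)).IsIrreducible)
    (hne : ∀ i j, Nonempty ((toRep (σ i)).Equiv (toRep (σ j))) → i = j) :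
    LinearIndependent ℂ fun i => (toRep (σ i)).character := by
  classical
  cases nonempty_fintype G
  have : Invertible (Nat.card G : ℂ) := invertibleOfNonzero (by simp)
  refine LinearIndependent.of_pairwise_dual_eq_zero_one _
    (fun j => (Nat.card G : ℂ)⁻¹ • ∑ g, (toRep (σ j)).character g⁻¹ • LinearMap.proj g) ?_ ?_
  · intro i j hij
    have := hσ i
    have := hσ j
    have h := Representation.char_orthonormal (toRep (σ j)) (toRep (σ i))
    rw [if_neg fun H => hij (hne _ _ H)] at h
    simpa [mul_comm] using h
  · intro i
    have := hσ i
    have h := Representation.char_orthonormal (toRep (σ i)) (toRep (σ i))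
    rw [if_pos ⟨Representation.Equiv.refl _⟩] at h
    simpa [mul_comm] using h

/-- Every finite group has a complete list of irreducible matrix representations, and it can be
taken unitary. The list is finite since characters of inequivalent irreducible representations are
linearly independent functions on the group. -/
theorem exists_unitary_isCompleteIrreducibleList [Finite G] :
    ∃ (k : ℕ) (d : Fin k → ℕ) (σ : ∀ i, G →* Matrix (Fin (d i)) (Fin (d i)) ℂ),
      IsCompleteIrreducibleList σ ∧ ∀ i g, σ i g⁻¹ = (σ i g)ᴴ := by
  -- Equivalence classes of irreducible matrix representations, all degrees taken together.
  let I := {τ : Σ c : ℕ, G →* Matrix (Fin c) (Fin c) ℂ // (toRep τ.2).IsIrreducible}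
  let r : Setoid I :=
    { r := fun τ τ' => Nonempty ((toRep τ.1.2).Equiv (toRep τ'.1.2))
      iseqv := ⟨fun τ => ⟨.refl _⟩, fun ⟨φ⟩ => ⟨φ.symm⟩, fun ⟨φ⟩ ⟨ψ⟩ => ⟨φ.trans ψ⟩⟩ }
  have hli := linearIndependent_characters (fun q : Quotient r => q.out.1.2) (fun q => q.out.2)
    fun p q h => by simpa using Quotient.sound (s := r) (a := p.out) (b := q.out) h
  have := hli.finite
  obtain ⟨k, ⟨f⟩⟩ := Finite.exists_equiv_fin (Quotient r)
  choose σ hσ hequiv using fun i : Fin k => exists_unitary_equiv (f.symm i).out.1.2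
  refine ⟨k, _, σ, ⟨fun i => ?_, fun i j h => ?_, fun c τ hτ => ?_⟩, hσ⟩
  · exact isIrreducible_of_equiv (hequiv i).some (f.symm i).out.2
  · apply f.symm.injective
    have h' : (f.symm i).out ≈ (f.symm j).out :=
      ⟨(hequiv i).some.trans (h.some.trans (hequiv j).some.symm)⟩
    simpa using Quotient.sound h'
  · refine ⟨f ⟦⟨⟨c, τ⟩, hτ⟩⟧, ?_⟩
    have h : (⟦⟨⟨c, τ⟩, hτ⟩⟧ : Quotient r).out ≈ ⟨⟨c, τ⟩, hτ⟩ := Quotient.mk_out _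
    rw [← f.symm_apply_apply ⟦_⟧] at h
    exact ⟨h.some.symm.trans (hequiv _).some⟩

/-- A simple `ℂ[G]`-module is given, in coordinates `φ`, by an irreducible matrix representation. -/
theorem exists_matrix_of_isSimpleModule [Finite G] (N : Type*) [AddCommGroup N] [Module ℂ N]
    [Module ℂ[G] N] [IsScalarTower ℂ ℂ[G] N] [IsSimpleModule ℂ[G] N] :
    ∃ (c : ℕ) (τ : G →* Matrix (Fin c) (Fin c) ℂ), (toRep τ).IsIrreducible ∧
      ∃ φ : N → Fin c → ℂ, Function.Injective φ ∧
        ∀ g v, φ (MonoidAlgebra.single g (1 : ℂ) • v) = toRep τ g (φ v) := by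
  have : Module.Finite ℂ N := Module.Finite.trans ℂ[G] N
  let ρ : Representation ℂ G N := Representation.ofModule' N
  obtain ⟨c, τ, ⟨φ⟩⟩ := exists_matrix_of_representation ρ
  have hsmul (r : ℂ[G]) (v : N) : ρ.asAlgebraHom r v = r • v := by
    simp [ρ, Representation.ofModule', Representation.asAlgebraHom]
  have hirr : ρ.IsIrreducible := by
    rw [Representation.irreducible_iff_isSimpleModule_asModule]
    let f : ρ.asModule ≃ₗ[ℂ[G]] N :=
      { ρ.asModuleEquiv with
        map_smul' := fun r v => (ρ.asModuleEquiv_map_smul r v).trans (hsmul r _) }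
    exact IsSimpleModule.congr f
  refine ⟨c, τ, isIrreducible_of_equiv φ hirr, φ.toLinearEquiv, φ.toLinearEquiv.injective,
    fun g v => ?_⟩
  have h := LinearMap.congr_fun (φ.isIntertwining' g) v
  rw [← hsmul, Representation.asAlgebraHom_single_one]
  exact h

/-- A complete list of irreducible representations separates the elements of the group: an
element acting trivially in all of them acts trivially on every simple submodule of `ℂ[G]`, hence
on `ℂ[G]` itself. -/
theorem IsCompleteIrreducibleList.eq_one [Finite G] {k : ℕ} {d : Fin k → ℕ}
    {σ : ∀ i, G →* Matrix (Fin (d i)) (Fin (d i)) ℂ} (hσ : IsCompleteIrreducibleList σ) {g : G}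
    (hg : ∀ i, σ i g = 1) : g = 1 := by
  have htriv (N : Submodule ℂ[G] ℂ[G]) (hN : IsSimpleModule ℂ[G] N) (v : ℂ[G]) (hv : v ∈ N) :
      MonoidAlgebra.single g (1 : ℂ) * v = v := by
    obtain ⟨c, τ, hτ, φ, hφ, hact⟩ := exists_matrix_of_isSimpleModule (G := G) N
    obtain ⟨i, ⟨ψ⟩⟩ := hσ.complete c τ hτ
    have hone : toRep τ g = 1 := by
      refine LinearMap.ext fun x => ?_
      apply ψ.toLinearEquiv.injective
      have h := LinearMap.congr_fun (ψ.isIntertwining' g) x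
      have h1 : toRep (σ i) g = 1 := by rw [toRep, MonoidHom.comp_apply, hg i, map_one]
      rw [h1] at h
      exact h
    have h := hact g ⟨v, hv⟩
    rw [hone] at h
    exact congrArg Subtype.val (hφ h)
  have htop (v : ℂ[G]) : MonoidAlgebra.single g (1 : ℂ) * v = v := by
    have hv : v ∈ sSup {N : Submodule ℂ[G] ℂ[G] | IsSimpleModule ℂ[G] N} := by
      rw [IsSemisimpleModule.sSup_simples_eq_top]; trivial
    rw [sSup_eq_iSup'] at hv
    induction hv using Submodule.iSup_induction' with
    | mem N v hv => exact htriv N.1 N.2 v hv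
    | zero => exact mul_zero _
    | add v w _ _ hv hw => rw [mul_add, hv, hw]
  have h1 := htop 1
  rw [mul_one, MonoidAlgebra.one_def] at h1
  exact MonoidAlgebra.of_injective (R := ℂ) h1

end IrreducibleReps

/-! ### Faithfulness of block matrices over `G ∪ {0}` -/

section Faithful

variable {G : Type*} [Group G]

open scoped MonoidAlgebra in
/-- The direct sum of a complete list has positive degree, so that its values are not `0`. -/
theorem IsCompleteIrreducibleList.nonempty_index [Finite G] {k : ℕ} {d : Fin k → ℕ}
    {σ : ∀ i, G →* Matrix (Fin (d i)) (Fin (d i)) ℂ} (hσ : IsCompleteIrreducibleList σ) :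
    Nonempty (Σ i, Fin (d i)) := by
  obtain ⟨N, hN⟩ := IsSemisimpleModule.exists_simple_submodule ℂ[G] ℂ[G]
  obtain ⟨c, τ, hτ, -⟩ := exists_matrix_of_isSimpleModule (G := G) N
  obtain ⟨i, -⟩ := hσ.complete c τ hτ
  by_contra hempty
  have : IsEmpty (Fin (d i)) := ⟨fun p => hempty ⟨⟨i, p⟩⟩⟩
  have hnt := (hσ.irreducible i).toNontrivial
  have : Subsingleton (Subrepresentation (toRep (σ i))) :=
    Subrepresentation.toSubmodule_injective.subsingleton
  exact not_subsingleton _ this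

theorem IsCompleteIrreducibleList.extendZero_injective [Finite G] {k : ℕ} {d : Fin k → ℕ}
    {σ : ∀ i, G →* Matrix (Fin (d i)) (Fin (d i)) ℂ} (hσ : IsCompleteIrreducibleList σ) :
    Function.Injective (extendZero (directSum σ)) := by
  have hne := hσ.nonempty_index
  have hcoe (g : G) : directSum σ g ≠ 0 := fun h => by
    have h1 : directSum σ (g * g⁻¹) = 0 := by rw [map_mul, h, zero_mul]
    rw [mul_inv_cancel, map_one] at h1
    exact one_ne_zero h1
  intro x y h
  cases x using WithZero.recZeroCoe with
  | zero =>
    cases y using WithZero.recZeroCoe with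
    | zero => rfl
    | coe g => exact absurd h.symm (hcoe g)
  | coe g =>
    cases y using WithZero.recZeroCoe with
    | zero => exact absurd h (hcoe g)
    | coe g' =>
      have hblocks : (fun i => σ i g) = fun i => σ i g' := Matrix.blockDiagonal'_injective h
      have h1 : g * g'⁻¹ = 1 := hσ.eq_one fun i => by
        rw [map_mul, congrFun hblocks i, ← map_mul, mul_inv_cancel, map_one]
      rw [mul_inv_eq_one.mp h1]

variable {κ : Type*} [Fintype κ] [DecidableEq κ]

theorem mapBlocks_injective {ι : Type*} {σ : G →* Matrix κ κ ℂ}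
    (hσ : Function.Injective (extendZero σ)) :
    Function.Injective (mapBlocks (ι := ι) σ) := by
  intro M N h
  ext1 j i
  apply hσ
  ext p q
  exact congrFun (congrFun h (j, p)) (i, q)

theorem mapBlocks_eq_conjTranspose {ι : Type*} {σ : G →* Matrix κ κ ℂ}
    (hσ : ∀ g, σ g⁻¹ = (σ g)ᴴ) {M N : Matrix ι ι (WithZero G)} (h : ∀ i j, N i j = (M j i)⁻¹) :
    mapBlocks σ N = (mapBlocks σ M)ᴴ := by
  have hinv (x : WithZero G) : extendZero σ x⁻¹ = (extendZero σ x)ᴴ := by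
    cases x using WithZero.recZeroCoe with
    | zero => rw [_root_.inv_zero, extendZero_zero, Matrix.conjTranspose_zero]
    | coe g => rw [← WithZero.coe_inv, extendZero_coe, extendZero_coe, hσ]
  ext ⟨i, p⟩ ⟨j, q⟩
  simp only [mapBlocks, of_apply, Matrix.conjTranspose_apply, h i j, hinv]

theorem directSum_inv_eq_conjTranspose {k : ℕ} {d : Fin k → ℕ}
    {σ : ∀ i, G →* Matrix (Fin (d i)) (Fin (d i)) ℂ} (hσ : ∀ i g, σ i g⁻¹ = (σ i g)ᴴ) (g : G) :
    directSum σ g⁻¹ = (directSum σ g)ᴴ := by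
  change Matrix.blockDiagonal' (fun i => σ i g⁻¹) = (Matrix.blockDiagonal' fun i => σ i g)ᴴ
  rw [Matrix.blockDiagonal'_conjTranspose]
  simp only [hσ]

end Faithful

/-! ### Green's relations at idempotents -/

section Green

variable {S : Type*} [Semigroup S]

theorem greenL_idempotent_iff {e x : S} (he : IsIdempotentElem e) :
    GreenL x e ↔ x * e = x ∧ ∃ t, t * x = e := by
  constructor
  · intro h
    have hx : x ∈ principalLeft e := h ▸ (Or.inl rfl : x ∈ principalLeft x)
    have h_e : e ∈ principalLeft x := h.symm ▸ (Or.inl rfl : e ∈ principalLeft e)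
    refine ⟨?_, ?_⟩
    · rcases hx with rfl | ⟨s, rfl⟩
      · exact he
      · rw [mul_assoc, he.eq]
    · rcases h_e with rfl | ⟨t, ht⟩
      · exact ⟨e, he⟩
      · exact ⟨t, ht.symm⟩
  · rintro ⟨hx, t, ht⟩
    refine Set.Subset.antisymm ?_ ?_
    · rintro b (rfl | ⟨v, rfl⟩)
      · exact Or.inr ⟨b, hx.symm⟩
      · exact Or.inr ⟨v * x, by rw [mul_assoc, hx]⟩
    · rintro b (rfl | ⟨v, rfl⟩)
      · exact Or.inr ⟨t, ht.symm⟩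
      · exact Or.inr ⟨v * t, by rw [mul_assoc, ht]⟩

theorem greenR_idempotent_iff {e x : S} (he : IsIdempotentElem e) :
    GreenR x e ↔ e * x = x ∧ ∃ t, x * t = e := by
  constructor
  · intro h
    have hx : x ∈ principalRight e := h ▸ (Or.inl rfl : x ∈ principalRight x)
    have h_e : e ∈ principalRight x := h.symm ▸ (Or.inl rfl : e ∈ principalRight e)
    refine ⟨?_, ?_⟩
    · rcases hx with rfl | ⟨s, rfl⟩
      · exact he
      · rw [← mul_assoc, he.eq]
    · rcases h_e with rfl | ⟨t, ht⟩
      · exact ⟨e, he⟩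
      · exact ⟨t, ht.symm⟩
  · rintro ⟨hx, t, ht⟩
    refine Set.Subset.antisymm ?_ ?_
    · rintro b (rfl | ⟨v, rfl⟩)
      · exact Or.inr ⟨b, hx.symm⟩
      · exact Or.inr ⟨x * v, by rw [← mul_assoc, hx]⟩
    · rintro b (rfl | ⟨v, rfl⟩)
      · exact Or.inr ⟨t, ht.symm⟩
      · exact Or.inr ⟨t * v, by rw [← mul_assoc, ht]⟩

theorem exists_eq_mul_mul_of_mem_principalTwoSided {a b u : S} (hu : a * u * a = a)
    (h : b ∈ principalTwoSided a) : ∃ s t, b = s * a * t := by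
  rcases h with rfl | ⟨s, rfl⟩ | ⟨t, rfl⟩ | h
  · exact ⟨b * u, u * b, by rw [hu, ← mul_assoc, hu]⟩
  · exact ⟨s, u * a, by rw [mul_assoc, ← mul_assoc a, hu]⟩
  · exact ⟨a * u, t, by rw [hu]⟩
  · exact h

theorem greenJ_mul_self {a b : S} (h : a * b * a = a) : GreenJ (b * a) a := by
  refine Set.Subset.antisymm ?_ ?_
  · rintro c (rfl | ⟨s, rfl⟩ | ⟨t, rfl⟩ | ⟨s, t, rfl⟩)
    · exact Or.inr (Or.inl ⟨b, rfl⟩)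
    · exact Or.inr (Or.inl ⟨s * b, (mul_assoc _ _ _).symm⟩)
    · exact Or.inr (Or.inr (Or.inr ⟨b, t, rfl⟩))
    · exact Or.inr (Or.inr (Or.inr ⟨s * b, t, by simp only [mul_assoc]⟩))
  · rintro c (rfl | ⟨s, rfl⟩ | ⟨t, rfl⟩ | ⟨s, t, rfl⟩)
    · exact Or.inr (Or.inl ⟨c, by rw [← mul_assoc, h]⟩)
    · exact Or.inr (Or.inl ⟨s * a, by rw [mul_assoc, ← mul_assoc a, h]⟩)
    · exact Or.inr (Or.inr (Or.inr ⟨a, t, by rw [← mul_assoc, h]⟩))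
    · exact Or.inr (Or.inr (Or.inr ⟨s * a, t, by
        rw [mul_assoc s a (b * a), ← mul_assoc a b, h, mul_assoc]⟩))

/-- Stability of finite semigroups: `e = c e d` implies that `c e` is `L`-equivalent to `e`.
Indeed `e = cⁿ e dⁿ` for all `n`, and two distinct powers of `c` act alike on `S`. -/
theorem exists_mul_eq_of_eq_mul_mul [Finite S] {c d e : S} (h : c * (e * d) = e) :
    ∃ t, t * (c * e) = e := by
  let F : S → S := (c * ·)
  let D : S → S := (· * d)
  have hcomm : Function.Commute F D := fun z => (mul_assoc c z d).symm
  have hfix (n : ℕ) : F^[n] (D^[n] e) = e := by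
    have h1 : (F ∘ D) e = e := h
    have h2 := Function.iterate_fixed h1 n
    rwa [hcomm.comp_iterate] at h2
  -- The period is written `k + 1` so that it is positive.
  obtain ⟨n, k, hnk⟩ : ∃ n k, F^[n] = F^[n + (k + 1)] := by
    obtain ⟨n, m, hne, hnm⟩ := Finite.exists_ne_map_eq_of_infinite fun n : ℕ => F^[n]
    rcases lt_or_gt_of_ne hne with hlt | hlt
    · exact ⟨n, m - n - 1, by rwa [show n + (m - n - 1 + 1) = m by omega]⟩
    · exact ⟨m, n - m - 1, by rw [show m + (n - m - 1 + 1) = n by omega]; exact hnm.symm⟩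
  have hper : F^[k] (c * e) = e := by
    change F^[k + 1] e = e
    nth_rw 1 [← hfix n]
    rw [← Function.iterate_add_apply, add_comm, ← hnk, hfix]
  have hassoc (j : ℕ) (z w : S) : F^[j] (z * w) = F^[j] z * w := by
    induction j with
    | zero => rfl
    | succ j ih => rw [Function.iterate_succ_apply', Function.iterate_succ_apply', ih, mul_assoc]
  cases k with
  | zero =>
    have hce : c * e = e := hper
    exact ⟨c, by rw [hce, hce]⟩
  | succ k =>
    rw [Function.iterate_succ_apply] at hper
    exact ⟨F^[k] c, by rw [← hassoc]; exact hper⟩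

/-- In a finite semigroup `J`-equivalent idempotents are `D`-equivalent. -/
theorem exists_greenL_greenR [Finite S] {e f p q r s : S} (he : IsIdempotentElem e)
    (hf : IsIdempotentElem f) (h_e : e = p * f * q) (h_f : f = r * e * s) :
    ∃ x, GreenL x e ∧ GreenR x f := by
  have hfx : f = f * r * e * (s * f) := by
    calc f = f * f * f := by rw [hf.eq, hf.eq]
      _ = f * (r * e * s) * f := by rw [← h_f]
      _ = f * r * e * (s * f) := by simp only [mul_assoc]
  obtain ⟨t, ht⟩ := exists_mul_eq_of_eq_mul_mul (c := p * (f * r)) (d := s * f * q) (e := e) (by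
    calc p * (f * r) * (e * (s * f * q)) = p * (f * r * e * (s * f)) * q := by
          simp only [mul_assoc]
      _ = e := by rw [← hfx, ← h_e])
  refine ⟨f * r * e, (greenL_idempotent_iff he).2 ⟨by rw [mul_assoc, he.eq], t * p, ?_⟩,
    (greenR_idempotent_iff hf).2 ⟨by rw [← mul_assoc, ← mul_assoc, hf.eq], s * f, hfx.symm⟩⟩
  simpa only [mul_assoc] using ht

end Green

/-! ### Schützenberger representations separate points -/

section Separation

variable {S : Type*} [Semigroup S] {e : S} {he : IsIdempotentElem e} {m n : ℕ}

instance [Finite S] : Finite (MaxSubgroup he) :=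
  Finite.of_injective toS fun _ _ => toS_injective

theorem LeftTransversal.mul_eq_of_coeff_eq (X : LeftTransversal he m) {a b x : S}
    (hab : X.coeff a = X.coeff b) (hx : GreenL x e) (hax : GreenL (a * x) e) :
    a * x = b * x := by
  obtain ⟨i, g, rfl⟩ := X.cover x hx
  obtain ⟨j, h, hj⟩ := X.cover _ hax
  have ha : a * X.x i = X.x j * toS (h * g⁻¹) := by
    rw [toS_mul, ← mul_assoc, ← hj, mul_assoc, mul_assoc, toS_mul_inv, X.x_mul_e]
  have hb : b * X.x i = X.x j * toS (h * g⁻¹) := by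
    by_contra hne
    have hcoeff := X.coeff_eq ha
    rw [hab] at hcoeff
    by_cases hex : ∃ g' : MaxSubgroup he, b * X.x i = X.x j * toS g'
    · obtain ⟨g', hg'⟩ := hex
      rw [X.coeff_eq hg', WithZero.coe_inj] at hcoeff
      exact hne (hcoeff ▸ hg')
    · rw [X.coeff_zero fun g' hg' => hex ⟨g', hg'⟩] at hcoeff
      exact WithZero.zero_ne_coe hcoeff
  rw [← mul_assoc, ← mul_assoc, ha, hb]

theorem RightTransversal.mul_eq_of_coeff_eq (Y : RightTransversal he n) {a b y : S}
    (hab : Y.coeff a = Y.coeff b) (hy : GreenR y e) (hya : GreenR (y * a) e) :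
    y * a = y * b := by
  obtain ⟨i, g, rfl⟩ := Y.cover y hy
  obtain ⟨j, h, hj⟩ := Y.cover _ hya
  have ha : Y.y i * a = toS (g⁻¹ * h) * Y.y j := by
    rw [toS_mul, mul_assoc, ← hj, ← mul_assoc, ← mul_assoc, toS_inv_mul, Y.e_mul_y]
  have hb : Y.y i * b = toS (g⁻¹ * h) * Y.y j := by
    by_contra hne
    have hcoeff := Y.coeff_eq ha
    rw [hab] at hcoeff
    by_cases hex : ∃ g' : MaxSubgroup he, Y.y i * b = toS g' * Y.y j
    · obtain ⟨g', hg'⟩ := hex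
      rw [Y.coeff_eq hg', WithZero.coe_inj] at hcoeff
      exact hne (hcoeff ▸ hg')
    · rw [Y.coeff_zero fun g' hg' => hex ⟨g', hg'⟩] at hcoeff
      exact WithZero.zero_ne_coe hcoeff
  rw [mul_assoc, mul_assoc, ha, hb]

theorem SchutzenbergerPair.exists_eq_mul_mul {a u : S} (P : SchutzenbergerPair a)
    (hu : a * u * a = a) : (∃ p q, P.e = p * a * q) ∧ ∃ r s, a = r * P.e * s := by
  have h_e : P.e ∈ principalTwoSided a :=
    (show principalTwoSided P.e = principalTwoSided a from P.mem) ▸ Or.inl rfl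
  have ha : a ∈ principalTwoSided P.e :=
    (show principalTwoSided P.e = principalTwoSided a from P.mem).symm ▸ Or.inl rfl
  exact ⟨exists_eq_mul_mul_of_mem_principalTwoSided hu h_e,
    exists_eq_mul_mul_of_mem_principalTwoSided (show P.e * P.e * P.e = P.e by rw [P.he.eq, P.he.eq])
      ha⟩

/-- With `x` in the intersection of `L_e` and of the `R`-class of the idempotent `u a`, the product
`a x` stays in `L_e`, so equality of left representations gives `a x = b x`; then cancel `x`. -/
theorem SchutzenbergerPair.eq_mul_of_left_eq [Finite S] {a b u : S} (P : SchutzenbergerPair a)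
    (hu : a * u * a = a) (h : P.left a = P.left b) : a = b * (u * a) := by
  have hf : IsIdempotentElem (u * a) := by
    rw [IsIdempotentElem, mul_assoc, ← mul_assoc a, hu]
  obtain ⟨⟨p, q, hpq⟩, r, s, hrs⟩ := P.exists_eq_mul_mul hu
  obtain ⟨x, hxL, hxR⟩ := exists_greenL_greenR P.he hf (p := p * a) (q := q) (r := u * r) (s := s)
    (by rw [mul_assoc p, ← mul_assoc a, hu, ← hpq])
    (by rw [mul_assoc u, mul_assoc u, ← hrs])
  obtain ⟨hxe, t, ht⟩ := (greenL_idempotent_iff P.he).1 hxL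
  obtain ⟨hfx, v, hv⟩ := (greenR_idempotent_iff hf).1 hxR
  have hax : GreenL (a * x) P.e := (greenL_idempotent_iff P.he).2
    ⟨by rw [mul_assoc, hxe], t * u, by rw [mul_assoc, ← mul_assoc u, hfx, ht]⟩
  have hcoeff : P.X.coeff a = P.X.coeff b :=
    mapBlocks_injective P.complete.extendZero_injective h
  have hx := P.X.mul_eq_of_coeff_eq hcoeff hxL hax
  rw [← hv, ← mul_assoc, ← hx, mul_assoc, hv, ← mul_assoc, hu]

/-- The left-right dual of `SchutzenbergerPair.eq_mul_of_left_eq`. -/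
theorem SchutzenbergerPair.eq_mul_of_right_eq [Finite S] {a b u : S} (P : SchutzenbergerPair a)
    (hu : a * u * a = a) (h : P.right a = P.right b) : a = a * u * b := by
  have hf : IsIdempotentElem (a * u) := by
    rw [IsIdempotentElem, ← mul_assoc, hu]
  obtain ⟨⟨p, q, hpq⟩, r, s, hrs⟩ := P.exists_eq_mul_mul hu
  obtain ⟨y, hyL, hyR⟩ := exists_greenL_greenR hf P.he (p := r) (q := s * u) (r := p) (s := a * q)
    (by rw [← mul_assoc, ← hrs])
    (by rw [← mul_assoc, mul_assoc p, hu, ← hpq])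
  obtain ⟨hyf, t, ht⟩ := (greenL_idempotent_iff hf).1 hyL
  obtain ⟨hey, v, hv⟩ := (greenR_idempotent_iff P.he).1 hyR
  have hya : GreenR (y * a) P.e := (greenR_idempotent_iff P.he).2
    ⟨by rw [← mul_assoc, hey], u * v, by
      rw [← mul_assoc, mul_assoc y, hyf, hv]⟩
  have hcoeff : P.Y.coeff a = P.Y.coeff b :=
    mapBlocks_injective P.complete.extendZero_injective h
  have hy := P.Y.mul_eq_of_coeff_eq hcoeff hyR hya
  rw [← ht, mul_assoc, ← hy, ← mul_assoc, ht, hu]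

theorem eq_of_left_eq_of_right_eq [Finite S] (hreg : IsRegularSemigroup S) {a b : S}
    (P : SchutzenbergerPair a) (Q : SchutzenbergerPair b) (hP : P.left a = P.left b)
    (hQ : Q.right a = Q.right b) : a = b := by
  obtain ⟨u, hu⟩ := hreg a
  obtain ⟨v, hv⟩ := hreg b
  have ha := P.eq_mul_of_left_eq hu hP
  have hb := Q.eq_mul_of_right_eq hv hQ.symm
  calc a = b * (u * a) := ha
    _ = b * v * a * (u * a) := congrArg (· * (u * a)) hb
    _ = b * v * a := by rw [mul_assoc (b * v), ← mul_assoc a, hu]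
    _ = b := hb.symm

end Separation

/-! ### Inverse semigroups whose inversion is the involution -/

section Involution

variable {S : Type*} [Semigroup S] [StarMul S]

/-- If all idempotents are self-adjoint, then `(ef)* = fe` and `ef = (ef)(ef)*(ef) = (ef)²`, so the
idempotent `ef` equals `fe`. -/
theorem commute_of_isIdempotentElem (hs : ∀ a : S, a * star a * a = a)
    (hidem : ∀ e : S, IsIdempotentElem e → star e = e) {e f : S} (he : IsIdempotentElem e)
    (hf : IsIdempotentElem f) : e * f = f * e := by
  have hef : IsIdempotentElem (e * f) := by
    have h := hs (e * f)
    rw [star_mul, hidem e he, hidem f hf] at h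
    calc e * f * (e * f) = e * (f * f) * (e * e) * f := by rw [hf.eq, he.eq]; simp only [mul_assoc]
      _ = e * f * (f * e) * (e * f) := by simp only [mul_assoc]
      _ = e * f := h
  rw [← hidem _ hef, star_mul, hidem e he, hidem f hf]

theorem isInverseSemigroupWith_star (hs : ∀ a : S, a * star a * a = a)
    (hidem : ∀ e : S, IsIdempotentElem e → star e = e) :
    IsInverseSemigroupWith (star : S → S) := by
  have hs' (a : S) : star a * a * star a = star a := by
    simpa only [star_star] using hs (star a)
  refine ⟨fun a => ⟨star a, ⟨hs a, hs' a⟩, ?_⟩, fun a => ⟨hs a, hs' a⟩⟩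
  suffices huniq : ∀ b c : S, a * b * a = a → b * a * b = b → a * c * a = a → c * a * c = c →
      b = c by
    rintro b ⟨h1, h2⟩
    exact huniq b _ h1 h2 (hs a) (hs' a)
  intro b c hb1 hb2 hc1 hc2
  have hr {d : S} (hd : a * d * a = a) : IsIdempotentElem (a * d) := by
    rw [IsIdempotentElem, ← mul_assoc, hd]
  have hl {d : S} (hd : a * d * a = a) : IsIdempotentElem (d * a) := by
    rw [IsIdempotentElem, mul_assoc, ← mul_assoc a, hd]
  calc b = b * (a * c * a) * b := by rw [hc1, hb2]
    _ = b * ((a * c) * (a * b)) := by simp only [mul_assoc]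
    _ = b * ((a * b) * (a * c)) := by
      rw [commute_of_isIdempotentElem hs hidem (hr hc1) (hr hb1)]
    _ = (b * a * b) * a * c := by simp only [mul_assoc]
    _ = b * a * (c * a * c) := by rw [hb2, hc2]
    _ = (b * a) * (c * a) * c := by simp only [mul_assoc]
    _ = (c * a) * (b * a) * c := by
      rw [commute_of_isIdempotentElem hs hidem (hl hb1) (hl hc1)]
    _ = c * (a * b * a) * c := by simp only [mul_assoc]
    _ = c := by rw [hb1, hc2]

theorem IsInverseSemigroupWith.star_eq_of_isIdempotentElem
    (h : IsInverseSemigroupWith (star : S → S)) {e : S} (he : IsIdempotentElem e) : star e = e :=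
  (h.1 e).unique (h.2 e) ⟨by rw [he.eq, he.eq], by rw [he.eq, he.eq]⟩

/-- `star x * x` is the idempotent of the `L`-class of `x`. -/
theorem star_mul_self_eq_of_greenL {e x : S} (hs : x * star x * x = x) (he : IsIdempotentElem e)
    (he' : star e = e) (hx : GreenL x e) : star x * x = e := by
  obtain ⟨hxe, t, rfl⟩ := (greenL_idempotent_iff he).1 hx
  have h1 : t * x * (star x * x) = t * x := by rw [mul_assoc t, ← mul_assoc x, hs]
  have h2 := congrArg star h1
  rw [star_mul, star_mul (star x), star_star, he'] at h2
  rw [← h2, mul_assoc, hxe]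

theorem GreenL.star_greenR {e x : S} (he : IsIdempotentElem e) (he' : star e = e)
    (hx : GreenL x e) : GreenR (star x) e := by
  obtain ⟨hxe, t, ht⟩ := (greenL_idempotent_iff he).1 hx
  exact (greenR_idempotent_iff he).2 ⟨by rw [← he', ← star_mul, hxe],
    star t, by rw [← star_mul, ht, he']⟩

theorem GreenR.star_greenL {e y : S} (he : IsIdempotentElem e) (he' : star e = e)
    (hy : GreenR y e) : GreenL (star y) e := by
  obtain ⟨hey, t, ht⟩ := (greenR_idempotent_iff he).1 hy
  exact (greenL_idempotent_iff he).2 ⟨by rw [← he', ← star_mul, hey],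
    star t, by rw [← star_mul, ht, he']⟩

variable {e : S} {he : IsIdempotentElem e} {m n : ℕ}

theorem IsInverseSemigroupWith.star_toS (h : IsInverseSemigroupWith (star : S → S))
    (g : MaxSubgroup he) : star (toS g) = toS g⁻¹ :=
  (h.1 (toS g)).unique (h.2 _)
    ⟨by rw [toS_mul_inv, e_mul_toS], by rw [toS_inv_mul, e_mul_toS]⟩

/-- Left translation by `star s` inverts left translation by `s` on `L_e`: both `star s * s` and
`x * star x` are idempotents, they commute, and this yields `star s * s * x = x`. -/
theorem IsInverseSemigroupWith.star_mul_eq (h : IsInverseSemigroupWith (star : S → S))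
    {s x y : S} {g : MaxSubgroup he} (hx : GreenL x e) (hy : GreenL y e)
    (hs : s * x = y * toS g) : star s * y = x * toS g⁻¹ := by
  have hidem (f : S) (hf : IsIdempotentElem f) : star f = f := h.star_eq_of_isIdempotentElem hf
  have hxx := star_mul_self_eq_of_greenL (h.2 x).1 he (hidem e he) hx
  have hyy := star_mul_self_eq_of_greenL (h.2 y).1 he (hidem e he) hy
  obtain ⟨hxe, -⟩ := (greenL_idempotent_iff he).1 hx
  obtain ⟨hye, -⟩ := (greenL_idempotent_iff he).1 hy
  have hssx : star x * star s * (s * x) = e := by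
    rw [← star_mul, hs, star_mul, h.star_toS, mul_assoc, ← mul_assoc (star y), hyy, e_mul_toS,
      toS_inv_mul]
  have hs_idem : IsIdempotentElem (star s * s) := by
    rw [IsIdempotentElem, ← mul_assoc, (h.2 s).2]
  have hx_idem : IsIdempotentElem (x * star x) := by
    rw [IsIdempotentElem, ← mul_assoc, (h.2 x).1]
  have hcomm := commute_of_isIdempotentElem (fun a => (h.2 a).1) hidem hs_idem hx_idem
  have hfix : star s * (s * x) = x := by
    calc star s * (s * x) = star s * s * (x * star x) * x := by
          rw [mul_assoc _ (x * star x), (h.2 x).1, mul_assoc]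
      _ = x * (star x * star s * (s * x)) := by rw [hcomm]; simp only [mul_assoc]
      _ = x := by rw [hssx, hxe]
  calc star s * y = star s * (y * toS g * toS g⁻¹) := by rw [mul_assoc y, toS_mul_inv, hye]
    _ = star s * (s * x) * toS g⁻¹ := by rw [← hs, ← mul_assoc]
    _ = x * toS g⁻¹ := by rw [hfix]

theorem LeftTransversal.coeff_star (X : LeftTransversal he m)
    (h : IsInverseSemigroupWith (star : S → S)) (s : S) (i j : Fin m) :
    X.coeff (star s) i j = (X.coeff s j i)⁻¹ := by
  by_cases hex : ∃ g : MaxSubgroup he, s * X.x i = X.x j * toS g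
  · obtain ⟨g, hg⟩ := hex
    rw [X.coeff_eq hg, X.coeff_eq (h.star_mul_eq (X.mem i) (X.mem j) hg), WithZero.coe_inv]
  · rw [X.coeff_zero fun g hg => hex ⟨g, hg⟩, X.coeff_zero, _root_.inv_zero]
    intro g hg
    have hg' := h.star_mul_eq (X.mem j) (X.mem i) hg
    rw [star_star] at hg'
    exact hex ⟨_, hg'⟩

theorem IsInverseSemigroupWith.mul_star_eq (h : IsInverseSemigroupWith (star : S → S))
    {s x y : S} {g : MaxSubgroup he} (hx : GreenR x e) (hy : GreenR y e)
    (hs : y * s = toS g * x) : x * star s = toS g⁻¹ * y := by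
  have he' := h.star_eq_of_isIdempotentElem he
  have hstar : star s * star y = star x * toS g⁻¹ := by
    rw [← h.star_toS, ← star_mul, hs, star_mul]
  have h1 := congrArg star (h.star_mul_eq (hy.star_greenL he he') (hx.star_greenL he he') hstar)
  simpa only [star_mul, star_star, h.star_toS, inv_inv] using h1

theorem RightTransversal.coeff_star (Y : RightTransversal he n)
    (h : IsInverseSemigroupWith (star : S → S)) (s : S) (i j : Fin n) :
    Y.coeff (star s) i j = (Y.coeff s j i)⁻¹ := by
  by_cases hex : ∃ g : MaxSubgroup he, Y.y j * s = toS g * Y.y i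
  · obtain ⟨g, hg⟩ := hex
    rw [Y.coeff_eq hg, Y.coeff_eq (h.mul_star_eq (Y.mem i) (Y.mem j) hg), WithZero.coe_inv]
  · rw [Y.coeff_zero fun g hg => hex ⟨g, hg⟩, Y.coeff_zero, _root_.inv_zero]
    intro g hg
    have hg' := h.mul_star_eq (Y.mem j) (Y.mem i) hg
    rw [star_star] at hg'
    exact hex ⟨_, hg'⟩

theorem IsStarRepresentation.isSemiunitary {ι : Type*} [Fintype ι] {π : S →ₙ* Matrix ι ι ℂ}
    (hπ : IsStarRepresentation π) (hs : ∀ a : S, a * star a * a = a) : IsSemiunitary π := by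
  intro s
  rw [IsPreunitary, ← hπ s, ← map_mul, ← map_mul, hs]

end Involution

/-! ### Existence of transversals -/

section Existence

variable {S : Type*} [Semigroup S] {e : S}

/-- A transversal of the orbits of the right action of `G_e` on `L_e`. -/
theorem exists_leftTransversal [Finite S] (he : IsIdempotentElem e) :
    ∃ m, Nonempty (LeftTransversal he m) := by
  have hxe {x : S} (hx : GreenL x e) : x * e = x := ((greenL_idempotent_iff he).1 hx).1
  let r : Setoid {x : S // GreenL x e} :=
    { r := fun x y => ∃ g : MaxSubgroup he, x.1 = y.1 * toS g
      iseqv :=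
        { refl := fun x => ⟨1, by rw [toS_one, hxe x.2]⟩
          symm := by
            rintro x y ⟨g, hg⟩
            exact ⟨g⁻¹, by rw [hg, mul_assoc, toS_mul_inv, hxe y.2]⟩
          trans := by
            rintro x y z ⟨g, hg⟩ ⟨h, hh⟩
            exact ⟨h * g, by rw [hg, hh, toS_mul, mul_assoc]⟩ } }
  obtain ⟨m, ⟨f⟩⟩ := Finite.exists_equiv_fin (Quotient r)
  refine ⟨m, ⟨⟨fun i => (f.symm i).out.1, fun i => (f.symm i).out.2, fun b hb => ?_, ?_⟩⟩⟩
  · obtain ⟨g, hg⟩ := r.symm (Quotient.mk_out (⟨b, hb⟩ : {x : S // GreenL x e}))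
    exact ⟨f ⟦⟨b, hb⟩⟧, g, by rw [f.symm_apply_apply]; exact hg⟩
  · intro i j g h hgh
    have hrel : (f.symm i).out ≈ (f.symm j).out := ⟨h * g⁻¹, by
      rw [toS_mul, ← mul_assoc, ← hgh, mul_assoc, toS_mul_inv, hxe (f.symm i).out.2]⟩
    simpa using Quotient.sound hrel

/-- The involution of an inverse semigroup turns a decomposition of `L_e` into one of `R_e`. -/
theorem LeftTransversal.nonempty_rightTransversal [StarMul S] {he : IsIdempotentElem e} {m : ℕ}
    (X : LeftTransversal he m) (h : IsInverseSemigroupWith (star : S → S)) :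
    Nonempty (RightTransversal he m) := by
  have he' := h.star_eq_of_isIdempotentElem he
  refine ⟨⟨fun i => star (X.x i), fun i => (X.mem i).star_greenR he he', fun b hb => ?_,
    fun i j g k hgk => ?_⟩⟩
  · obtain ⟨i, g, hg⟩ := X.cover _ (hb.star_greenL he he')
    exact ⟨i, g⁻¹, by rw [← h.star_toS, ← star_mul, ← hg, star_star]⟩
  · refine X.disjoint i j g⁻¹ k⁻¹ ?_
    have h1 := congrArg star hgk
    simpa only [star_mul, star_star, h.star_toS] using h1

end Existence

/-! ### Idempotent partial isometries and the equivalence -/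

open scoped ComplexOrder in
/-- A partial isometry that is idempotent is an orthogonal projection: the hypotheses make
`(A - A * Aᴴ) * (A - A * Aᴴ)ᴴ` vanish. -/
theorem IsPreunitary.conjTranspose_eq_self {ι : Type*} [Fintype ι] {A : Matrix ι ι ℂ}
    (hA : IsPreunitary A) (hidem : A * A = A) : Aᴴ = A := by
  have hA' : A * Aᴴ * A = A := hA
  have hidem' : Aᴴ * Aᴴ = Aᴴ := by rw [← Matrix.conjTranspose_mul, hidem]
  have hzero : (A - A * Aᴴ) * (A - A * Aᴴ)ᴴ = 0 := by
    rw [Matrix.conjTranspose_sub, Matrix.conjTranspose_mul, Matrix.conjTranspose_conjTranspose]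
    have h1 : A * (A * Aᴴ) = A * Aᴴ := by rw [← mul_assoc, hidem]
    have h2 : A * Aᴴ * Aᴴ = A * Aᴴ := by rw [mul_assoc, hidem']
    have h3 : A * Aᴴ * (A * Aᴴ) = A * Aᴴ := by rw [← mul_assoc, hA']
    rw [sub_mul, mul_sub, mul_sub, h1, h2, h3, sub_self]
  have hself : A = A * Aᴴ := sub_eq_zero.mp (Matrix.self_mul_conjTranspose_eq_zero.mp hzero)
  rw [hself, Matrix.conjTranspose_mul, Matrix.conjTranspose_conjTranspose]

end SchutzenbergerRep

theorem mainTheorem2 {S : Type*} [Semigroup S] [Finite S] [StarMul S]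
    (hreg : SchutzenbergerRep.IsRegularSemigroup S) :
    SchutzenbergerRep.IsInverseSemigroupWith (star : S → S) ↔
      ∀ a : S, ∃ P : SchutzenbergerRep.SchutzenbergerPair a,
        (SchutzenbergerRep.IsSemiunitary P.left ∧
          SchutzenbergerRep.IsStarRepresentation P.left) ∧
        (SchutzenbergerRep.IsSemiunitary P.right ∧
          SchutzenbergerRep.IsStarRepresentation P.right) := by
  open SchutzenbergerRep in
  constructor
  · intro h a
    have he : IsIdempotentElem (star a * a) := by
      rw [IsIdempotentElem, ← mul_assoc, (h.2 a).2]
    obtain ⟨m, ⟨X⟩⟩ := exists_leftTransversal he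
    obtain ⟨Y⟩ := X.nonempty_rightTransversal h
    obtain ⟨k, d, σ, hσ, hunit⟩ := exists_unitary_isCompleteIrreducibleList (G := MaxSubgroup he)
    let P : SchutzenbergerPair a :=
      { e := star a * a, he := he, mem := greenJ_mul_self (h.2 a).1, m := m, n := m, X := X, Y := Y,
        k := k, d := d, σ := σ, complete := hσ }
    have hleft : IsStarRepresentation P.left := fun s =>
      mapBlocks_eq_conjTranspose (directSum_inv_eq_conjTranspose hunit) (X.coeff_star h s)
    have hright : IsStarRepresentation P.right := fun s =>
      mapBlocks_eq_conjTranspose (directSum_inv_eq_conjTranspose hunit) (Y.coeff_star h s)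
    have hs (b : S) : b * star b * b = b := (h.2 b).1
    exact ⟨P, ⟨hleft.isSemiunitary hs, hleft⟩, hright.isSemiunitary hs, hright⟩
  · intro H
    choose P hP using H
    have hcube {ι : Type} [Fintype ι] {π : S →ₙ* Matrix ι ι ℂ} (hsemi : IsSemiunitary π)
        (hstar : IsStarRepresentation π) (a : S) : π (a * star a * a) = π a := by
      rw [map_mul, map_mul, hstar a]
      exact hsemi a
    have hself {ι : Type} [Fintype ι] {π : S →ₙ* Matrix ι ι ℂ} (hsemi : IsSemiunitary π)
        (hstar : IsStarRepresentation π) {e : S} (he : IsIdempotentElem e) : π (star e) = π e := by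
      rw [hstar e]
      exact (hsemi e).conjTranspose_eq_self (by rw [← map_mul, he.eq])
    refine isInverseSemigroupWith_star (fun a => ?_) fun e he => ?_
    · exact eq_of_left_eq_of_right_eq hreg (P _) (P a) (hcube (hP _).1.1 (hP _).1.2 a)
        (hcube (hP a).2.1 (hP a).2.2 a)
    · exact eq_of_left_eq_of_right_eq hreg (P _) (P e) (hself (hP _).1.1 (hP _).1.2 he)
        (hself (hP e).2.1 (hP e).2.2 he)
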